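/- A Markov decision process (MDP) $\mathcal M=\langle Q,A,\delta\rangle$ has a finite set $Q$ of states, a finite set $A$ of actions and a transition function $\delta:Q\times A\to\mathcal D(Q)$, where $\mathcal D(S)$ denotes the set of probability distributions on $S$. Let $\mathrm{post}(q,a)$ be the support of $\delta(q,a)$; for $T\subseteq Q$ let $\mathrm{Pre}(T)=\{q\in Q\mid \exists a\in A:\ \mathrm{post}(q,a)\subseteq T\}$, $\mathrm{Pre}^0(T)=T$ and $\mathrm{Pre}^{k}(T)=\mathrm{Pre}(\mathrm{Pre}^{k-1}(T))$ for $k>0$. A (randomized, history-dependent) strategy maps each finite path $q_0a_0q_1\dots q_n$ to a distribution on $A$; a strategy $\alpha$ and an initial distribution induce a probability measure $\Pr^\alpha$ on infinite paths $q_0a_0q_1a_1\dots$, and $\mathcal M^\alpha_n(T)=\Pr^\alpha(q_n\in T)$. Write $\Diamond T$ for the event that some $q_i$ lies in $T$. For $T\subseteq U\subseteq Q$, a state $q_0$ is *limit-sure eventually synchronizing in $T$ with support in $U$* if for every $\varepsilon>0$ there are a strategy $\alpha$ and an $n\in\mathbb N$ such that, starting from $q_0$, $\mathcal M^\alpha_n(T)\ge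 1-\varepsilon$ and $\mathcal M^\alpha_n(U)=1$. In an MDP, a state $s$ is *limit-sure winning* for $\Diamond T$ if $\sup_\alpha \Pr^\alpha(\Diamond T)=1$, where the paths start in $s$. Let $r>0$ and $Z\subseteq Q$ with $\mathrm{Pre}^r(Z)=Z$. Positions are the numbers $0,\dots,r-1$, with arithmetic modulo $r$. An action $a$ is *$Z$-safe* in the state $q$ at position $i$ if $q\in\mathrm{Pre}^i(Z)$ and $\mathrm{post}(q,a)\subseteq\mathrm{Pre}^{i-1}(Z)$, where the exponent $i-1$ is taken modulo $r$ in $\{0,\dots,r-1\}$. The MDP $\mathcal M_Z\times[r]$ has the states $Q\times\{0,\dots,r-1\}\cup\{\mathsf{sink}\}$ and the actions $A$. Its transition function $\delta'$ is given by $\delta'(\langle q,i\rangle,a)(\langle q',i-1\rangle)=\delta(q,a)(q')$ for all $q'\in Q$ if $a$ is $Z$-safe in $q$ at position $i$, and $\delta'(\langle q,i\rangle,a)(\mathsf{sink})=1$ otherwise; $\mathsf{sink}$ is absorbing. **Lemma.** Let $\mathcal M=\langle Q,A,\delta\rangle$ be an MDP, let $r>0$, and let $R\subseteq Z\subseteq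 Q$ satisfy $\mathrm{Pre}^r(R)=R$ and $\mathrm{Pre}^r(Z)=Z$. Then, for every state $q_0\in Q$, $q_0$ is limit-sure eventually synchronizing in $R$ with support in $Z$ if and only if there exists $0\le t<r$ such that $\langle q_0,t\rangle$ is limit-sure winning for $\Diamond(R\times\{0\})$ in the MDP $\mathcal M_Z\times[r]$. -/

import Mathlib

open MeasureTheory ProbabilityTheory
open scoped ENNReal

universe u v

/-- One step `q a` of a path `q₀ a₀ q₁ a₁ …`: a state and the action chosen there. -/
structure MDPStep (Q : Type u) (A : Type v) where
  state : Q
  action : A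

namespace MDPStep

variable {Q : Type u} {A : Type v}

/-- Steps carry the discrete σ-algebra, and sequences of steps the product σ-algebra. -/
instance : MeasurableSpace (MDPStep Q A) := ⊤

instance : DiscreteMeasurableSpace (MDPStep Q A) := ⟨fun _ => trivial⟩

instance [Countable Q] [Countable A] : Countable (MDPStep Q A) :=
  Function.Injective.countable (f := fun s : MDPStep Q A => (s.state, s.action)) (by
    rintro ⟨q, a⟩ ⟨q', a'⟩ h
    simpa using h)

end MDPStep

/-- A Markov decision process with states `Q`, actions `A` and transition function `δ`. The sets
`Q` and `A` are assumed to be finite where the process is used. -/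
structure MDP (Q : Type u) (A : Type v) where
  δ : Q → A → PMF Q

namespace MDP

variable {Q : Type u} {A : Type v}

/-- `post(q, a)`, the support of `δ(q, a)`. -/
def post (M : MDP Q A) (q : Q) (a : A) : Set Q := (M.δ q a).support

/-- `Pre(T)`, the states with an action all of whose successors are in `T`. Its `k`-fold iterate
is written `M.Pre^[k] T`. -/
def Pre (M : MDP Q A) (T : Set Q) : Set Q := {q | ∃ a : A, M.post q a ⊆ T}

/-- A randomized strategy: given a finite path `q₀ a₀ … qₙ₋₁ aₙ₋₁ qₙ`, presented as the sequence
of its first `n` steps together with its last state `qₙ`, it returns a distribution over actions.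
(It is a total function; its values on sequences that are not paths of the process at hand have
probability zero of being used.) -/
abbrev Strategy (Q : Type u) (A : Type v) : Type (max u v) :=
  (n : ℕ) → (Fin n → MDPStep Q A) → Q → PMF A

/-- Draw the next step: the state from `d`, then the action as `α` prescribes after the finite
path that consists of the steps `h` followed by that state. -/
noncomputable def drawStep (α : Strategy Q A) {n : ℕ} (h : Fin n → MDPStep Q A) (d : PMF Q) :
    PMF (MDPStep Q A) :=
  d.bind fun q => (α n h q).map fun a => ⟨q, a⟩

/-- The law of step `n + 1` given the steps `0, …, n`. -/
noncomputable def nextStep (M : MDP Q A) (α : Strategy Q A) (n : ℕ)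
    (h : Finset.Iic n → MDPStep Q A) : PMF (MDPStep Q A) :=
  drawStep α (n := n + 1) (fun i => h ⟨i, Finset.mem_Iic.2 (Nat.lt_succ_iff.1 i.2)⟩)
    (M.δ (h ⟨n, Finset.mem_Iic.2 le_rfl⟩).state (h ⟨n, Finset.mem_Iic.2 le_rfl⟩).action)

/-- `nextStep` as a Markov kernel. -/
noncomputable def stepKernel [Countable Q] [Countable A] (M : MDP Q A) (α : Strategy Q A)
    (n : ℕ) : Kernel (Finset.Iic n → MDPStep Q A) (MDPStep Q A) :=
  Kernel.ofFunOfCountable fun h => (M.nextStep α n h).toMeasure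

instance [Countable Q] [Countable A] (M : MDP Q A) (α : Strategy Q A) (n : ℕ) :
    IsMarkovKernel (M.stepKernel α n) :=
  ⟨fun h => PMF.toMeasure.isProbabilityMeasure (M.nextStep α n h)⟩

/-- The probability measure `Pr^α` on infinite sequences `q₀ a₀ q₁ a₁ …` that the strategy `α`
induces from the initial distribution `μ₀`. -/
noncomputable def pathMeasure [Countable Q] [Countable A] (M : MDP Q A) (μ₀ : PMF Q)
    (α : Strategy Q A) : Measure (ℕ → MDPStep Q A) :=
  Kernel.trajMeasure (X := fun _ => MDPStep Q A)
    (drawStep α (n := 0) Fin.elim0 μ₀).toMeasure (M.stepKernel α)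

/-- The event `◇T` of reaching `T`. -/
def reach (A : Type v) (T : Set Q) : Set (ℕ → MDPStep Q A) := {π | ∃ i, (π i).state ∈ T}

/-- The event `◇ᵏ T` of being in `T` after exactly `k` steps. -/
def reachAt (A : Type v) (k : ℕ) (T : Set Q) : Set (ℕ → MDPStep Q A) := {π | (π k).state ∈ T}

/-- `M` is limit-sure winning from `μ₀` for the event `Ω`: the supremum over all strategies `α` of
`Pr^α(Ω)` is `1`. -/
def LimitSureWinning [Countable Q] [Countable A] (M : MDP Q A) (μ₀ : PMF Q)
    (Ω : Set (ℕ → MDPStep Q A)) : Prop :=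
  (⨆ α : Strategy Q A, M.pathMeasure μ₀ α Ω) = 1

/-- The symbolic outcome: the distribution over states after `k` steps,
`M^α_k(q) = Pr^α(◇ᵏ {q})`. -/
noncomputable def symbolicOutcome [Countable Q] [Countable A] (M : MDP Q A) (μ₀ : PMF Q)
    (α : Strategy Q A) (k : ℕ) (q : Q) : ℝ≥0∞ :=
  M.pathMeasure μ₀ α (reachAt A k {q})

/-- `sum_T(X)`, the mass `X(T)` that `X` gives to `T`. -/
noncomputable def sumOn (T : Set Q) (X : Q → ℝ≥0∞) : ℝ≥0∞ := ∑' q : T, X q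

/-- The initial distributions that are limit-sure eventually synchronizing in `T` with (exact)
support in `U`. -/
def winLimitEvent [Countable Q] [Countable A] (M : MDP Q A) (T U : Set Q) : Set (PMF Q) :=
  {μ₀ | ∀ ε : ℝ, 0 < ε → ∃ (α : Strategy Q A) (n : ℕ),
    ENNReal.ofReal (1 - ε) ≤ sumOn T (M.symbolicOutcome μ₀ α n) ∧
      sumOn U (M.symbolicOutcome μ₀ α n) = 1}

/-- The action `a` is `Z`-safe in the state `q` at position `i` (modulo `r`). -/
def IsSafe (M : MDP Q A) (Z : Set Q) {r : ℕ} [NeZero r] (q : Q) (i : Fin r) (a : A) : Prop :=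
  q ∈ M.Pre^[(i : ℕ)] Z ∧ M.post q a ⊆ M.Pre^[((i - 1 : Fin r) : ℕ)] Z

/-- States of the product: `some (q, i)` is the pair `⟨q, i⟩`, and `none` is the sink. -/
abbrev ProductState (Q : Type u) (r : ℕ) : Type u := Option (Q × Fin r)

open Classical in
/-- The MDP `M_Z × [r]`; arithmetic on positions in `Fin r` is modulo `r`. -/
noncomputable def product (M : MDP Q A) (Z : Set Q) (r : ℕ) [NeZero r] :
    MDP (ProductState Q r) A where
  δ s a := match s with
    | some (q, i) =>
        if M.IsSafe Z q i a then (M.δ q a).map fun q' => some (q', i - 1) else PMF.pure none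
    | none => PMF.pure none

/-- The set `R × {0}` of states of the product. -/
def productTarget (R : Set Q) (r : ℕ) [NeZero r] : Set (ProductState Q r) :=
  {s | ∃ q ∈ R, s = some (q, 0)}

end MDP

/-! Let v_n(q) (`safeValue`) be the best probability of being in R after exactly n steps when only
actions that keep the process on course for Z are allowed. Both sides of the equivalence are
statements about v. Synchronizing means sup_n v_n(q₀) = 1 (`mem_winLimitEvent_iff`): a strategy with
all its mass in Z at time n almost surely plays allowed actions only, and a deterministic Markov
strategy attains v_n. Winning from ⟨q₀, t⟩ means that the supremum of v_n(q₀) over n ≡ t mod r is 1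
(`limitSureWinning_product_iff`). The position records the remaining time modulo r, so by Pre^r(Z) =
Z safety in the product is the restriction in v. Reaching R × {0} early costs nothing: by Pre^r(R) =
R the process can surely be back in R every r steps, so a hit within n steps is no likelier than
v_N(q₀) for any N ≥ n with N ≡ t. As there are finitely many residues, one of them carries the full
supremum. -/

namespace PMF

variable {α β : Type*}

/-! ### Expectations under discrete distributions -/

theorem lintegral_toMeasure [Countable α] [MeasurableSpace α] [DiscreteMeasurableSpace α]
    (p : PMF α) (f : α → ℝ≥0∞) : ∫⁻ x, f x ∂p.toMeasure = ∑' x, p x * f x := by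
  rw [lintegral_countable']
  refine tsum_congr fun x => ?_
  rw [p.toMeasure_apply_singleton x (measurableSet_singleton x), mul_comm]

theorem tsum_pure_mul (a : α) (f : α → ℝ≥0∞) : ∑' x, PMF.pure a x * f x = f a := by
  classical
  rw [tsum_eq_single a]
  · simp
  · intro b hb
    simp [PMF.pure_apply, hb]

theorem tsum_bind_mul (p : PMF α) (g : α → PMF β) (f : β → ℝ≥0∞) :
    ∑' b, p.bind g b * f b = ∑' a, p a * ∑' b, g a b * f b := by
  simp_rw [PMF.bind_apply, ← ENNReal.tsum_mul_right, ← ENNReal.tsum_mul_left]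
  rw [ENNReal.tsum_comm]
  simp_rw [mul_assoc]

theorem tsum_map_mul (p : PMF α) (g : α → β) (f : β → ℝ≥0∞) :
    ∑' b, p.map g b * f b = ∑' a, p a * f (g a) := by
  rw [PMF.map, tsum_bind_mul]
  simp_rw [Function.comp_apply, tsum_pure_mul]

theorem tsum_mul_le (p : PMF α) {f : α → ℝ≥0∞} {c : ℝ≥0∞} (h : ∀ x ∈ p.support, f x ≤ c) :
    ∑' x, p x * f x ≤ c := by
  calc ∑' x, p x * f x ≤ ∑' x, p x * c := by
        refine ENNReal.tsum_le_tsum fun x => ?_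
        by_cases hx : p x = 0
        · simp [hx]
        · exact mul_le_mul_right (h x ((p.mem_support_iff x).2 hx)) _
    _ = c := by rw [ENNReal.tsum_mul_right, p.tsum_coe, one_mul]

theorem le_tsum_mul (p : PMF α) {f : α → ℝ≥0∞} {c : ℝ≥0∞} (h : ∀ x ∈ p.support, c ≤ f x) :
    c ≤ ∑' x, p x * f x := by
  calc c = ∑' x, p x * c := by rw [ENNReal.tsum_mul_right, p.tsum_coe, one_mul]
    _ ≤ ∑' x, p x * f x := by
        refine ENNReal.tsum_le_tsum fun x => ?_
        by_cases hx : p x = 0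
        · simp [hx]
        · exact mul_le_mul_right (h x ((p.mem_support_iff x).2 hx)) _

end PMF

/-! ### One-step expectations and martingale bounds on path space -/

namespace MDP

variable {Q : Type u} {A : Type v}

/-- The expected value of `f` after playing `a` in `q`. -/
noncomputable def expect (M : MDP Q A) (f : Q → ℝ≥0∞) (q : Q) (a : A) : ℝ≥0∞ :=
  ∑' q', M.δ q a q' * f q'

theorem tsum_drawStep_mul (α : Strategy Q A) {n : ℕ} (h : Fin n → MDPStep Q A) (d : PMF Q)
    (F : MDPStep Q A → ℝ≥0∞) :
    ∑' s, drawStep α h d s * F s = ∑' q, d q * ∑' a, α n h q a * F ⟨q, a⟩ := by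
  rw [drawStep, PMF.tsum_bind_mul]
  simp_rw [PMF.tsum_map_mul]

theorem tsum_drawStep_state (α : Strategy Q A) {n : ℕ} (h : Fin n → MDPStep Q A) (d : PMF Q)
    (f : Q → ℝ≥0∞) : ∑' s, drawStep α h d s * f s.state = ∑' q, d q * f q := by
  rw [tsum_drawStep_mul α h d fun s => f s.state]
  simp_rw [ENNReal.tsum_mul_right, PMF.tsum_coe, one_mul]

theorem measurableSet_reachAt (n : ℕ) (T : Set Q) : MeasurableSet (reachAt A n T) :=
  measurable_pi_apply (X := fun _ => MDPStep Q A) n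
    (DiscreteMeasurableSpace.forall_measurableSet {s : MDPStep Q A | s.state ∈ T})

section PathMeasure

variable [Countable Q] [Countable A] (M : MDP Q A) (μ₀ : PMF Q) (α : Strategy Q A)

instance : IsProbabilityMeasure (M.pathMeasure μ₀ α) := by
  have := PMF.toMeasure.isProbabilityMeasure (drawStep α (n := 0) Fin.elim0 μ₀)
  unfold pathMeasure
  infer_instance

theorem map_zero_pathMeasure :
    (M.pathMeasure μ₀ α).map (fun π => π 0) = (drawStep α (n := 0) Fin.elim0 μ₀).toMeasure := by
  set p := (drawStep α (n := 0) Fin.elim0 μ₀).toMeasure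
  have h : (fun π : ℕ → MDPStep Q A => π 0)
      = (fun x : Finset.Iic 0 → MDPStep Q A => x ⟨0, Finset.mem_Iic.2 le_rfl⟩)
        ∘ Preorder.frestrictLe (π := fun _ => MDPStep Q A) 0 := rfl
  rw [h, ← Measure.map_map (by fun_prop) (by fun_prop), pathMeasure, Kernel.trajMeasure,
    Measure.map_comp _ _ (by fun_prop), Kernel.traj_map_frestrictLe, Kernel.partialTraj_self,
    Measure.id_comp, Measure.map_map (by fun_prop) (by fun_prop)]
  exact Measure.map_id

theorem lintegral_zero (F : MDPStep Q A → ℝ≥0∞) :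
    ∫⁻ π, F (π 0) ∂M.pathMeasure μ₀ α
      = ∑' q, μ₀ q * ∑' a, α 0 Fin.elim0 q a * F ⟨q, a⟩ := by
  rw [← tsum_drawStep_mul, ← PMF.lintegral_toMeasure, ← map_zero_pathMeasure M,
    lintegral_map (measurable_of_countable F) (by fun_prop)]

theorem lintegral_succ (n : ℕ) (F : (Finset.Iic n → MDPStep Q A) → MDPStep Q A → ℝ≥0∞) :
    ∫⁻ π, F (Preorder.frestrictLe n π) (π (n + 1)) ∂M.pathMeasure μ₀ α
      = ∫⁻ π, ∑' s, M.nextStep α n (Preorder.frestrictLe n π) s *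
          F (Preorder.frestrictLe n π) s ∂M.pathMeasure μ₀ α := by
  have := PMF.toMeasure.isProbabilityMeasure (drawStep α (n := 0) Fin.elim0 μ₀)
  have h := Kernel.map_frestrictLe_trajMeasure_compProd_eq_map_trajMeasure
    (X := fun _ => MDPStep Q A)
    (μ₀ := (drawStep α (n := 0) Fin.elim0 μ₀).toMeasure) (κ := M.stepKernel α) (a := n)
  change (M.pathMeasure μ₀ α).map _ ⊗ₘ _ = (M.pathMeasure μ₀ α).map _ at h
  have hm : Measurable fun x : (Finset.Iic n → MDPStep Q A) × MDPStep Q A => F x.1 x.2 :=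
    measurable_of_countable _
  calc ∫⁻ π, F (Preorder.frestrictLe n π) (π (n + 1)) ∂M.pathMeasure μ₀ α
      = ∫⁻ x, F x.1 x.2 ∂(M.pathMeasure μ₀ α).map
          fun π => (Preorder.frestrictLe n π, π (n + 1)) := by
        rw [lintegral_map hm (by fun_prop)]
    _ = ∫⁻ h, ∫⁻ s, F h s ∂M.stepKernel α n h
          ∂(M.pathMeasure μ₀ α).map (Preorder.frestrictLe n) := by
        rw [← h, Measure.lintegral_compProd hm]
    _ = _ := by
        rw [lintegral_map (measurable_of_countable _) (by fun_prop)]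
        refine lintegral_congr fun π => ?_
        exact PMF.lintegral_toMeasure _ _

/-- Given the prefix, the next state has law δ(qₙ, aₙ), whatever the strategy does afterwards. The
weight `G` allows conditioning on what the prefix has already visited. -/
theorem lintegral_succ_state (n : ℕ) (G : (Finset.Iic n → MDPStep Q A) → ℝ≥0∞)
    (f : Q → ℝ≥0∞) :
    ∫⁻ π, G (Preorder.frestrictLe n π) * f (π (n + 1)).state ∂M.pathMeasure μ₀ α
      = ∫⁻ π, G (Preorder.frestrictLe n π) * M.expect f (π n).state (π n).action
          ∂M.pathMeasure μ₀ α := by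
  rw [lintegral_succ M μ₀ α n fun h s => G h * f s.state]
  refine lintegral_congr fun π => ?_
  simp_rw [mul_left_comm _ (G _), ENNReal.tsum_mul_left]
  rw [nextStep, tsum_drawStep_state]
  rfl

theorem measurable_step (n : ℕ) (F : MDPStep Q A → ℝ≥0∞) :
    Measurable fun π : ℕ → MDPStep Q A => F (π n) :=
  (measurable_of_countable F).comp (measurable_pi_apply n)

theorem lintegral_state_succ (n : ℕ) (f : Q → ℝ≥0∞) :
    ∫⁻ π, f (π (n + 1)).state ∂M.pathMeasure μ₀ α
      = ∫⁻ π, M.expect f (π n).state (π n).action ∂M.pathMeasure μ₀ α := by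
  simpa using lintegral_succ_state M μ₀ α n (fun _ => 1) f

theorem lintegral_state_zero (f : Q → ℝ≥0∞) :
    ∫⁻ π, f (π 0).state ∂M.pathMeasure μ₀ α = ∑' q, μ₀ q * f q := by
  rw [lintegral_zero M μ₀ α fun s => f s.state]
  simp_rw [ENNReal.tsum_mul_right, PMF.tsum_coe, one_mul]

/-- The inequality is needed only almost everywhere, so it can exploit that a given strategy avoids
certain actions almost surely. -/
theorem lintegral_state_le_of_superharmonic {f : ℕ → Q → ℝ≥0∞} {n : ℕ}
    (h : ∀ k < n, ∀ᵐ π ∂M.pathMeasure μ₀ α,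
      M.expect (f (k + 1)) (π k).state (π k).action ≤ f k (π k).state) :
    ∫⁻ π, f n (π n).state ∂M.pathMeasure μ₀ α ≤ ∑' q, μ₀ q * f 0 q := by
  induction n with
  | zero => exact (lintegral_state_zero M μ₀ α (f 0)).le
  | succ n ih =>
    rw [lintegral_state_succ]
    exact (lintegral_mono_ae (h n n.lt_succ_self)).trans
      (ih fun k hk => h k (hk.trans n.lt_succ_self))

theorem le_lintegral_state_of_subharmonic {f : ℕ → Q → ℝ≥0∞} {n : ℕ}
    (h : ∀ k < n, ∀ᵐ π ∂M.pathMeasure μ₀ α,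
      f k (π k).state ≤ M.expect (f (k + 1)) (π k).state (π k).action) :
    ∑' q, μ₀ q * f 0 q ≤ ∫⁻ π, f n (π n).state ∂M.pathMeasure μ₀ α := by
  induction n with
  | zero => exact (lintegral_state_zero M μ₀ α (f 0)).ge
  | succ n ih =>
    rw [lintegral_state_succ]
    exact (ih fun k hk => h k (hk.trans n.lt_succ_self)).trans
      (lintegral_mono_ae (h n n.lt_succ_self))

/-- The strategy that plays `σ k q` in the state `q` at time `k`. -/
noncomputable def markovStrategy (σ : ℕ → Q → A) : Strategy Q A := fun n _ q => PMF.pure (σ n q)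

theorem markovStrategy_ae (σ : ℕ → Q → A) (k : ℕ) :
    ∀ᵐ π ∂M.pathMeasure μ₀ (markovStrategy σ), (π k).action = σ k (π k).state := by
  classical
  let F : MDPStep Q A → ℝ≥0∞ := fun s => if s.action = σ k s.state then 0 else 1
  have hF : ∫⁻ π, F (π k) ∂M.pathMeasure μ₀ (markovStrategy σ) = 0 := by
    cases k with
    | zero =>
      rw [lintegral_zero M μ₀ _ F]
      simp_rw [markovStrategy, PMF.tsum_pure_mul, F]
      simp
    | succ k =>
      rw [lintegral_succ M μ₀ _ k fun _ s => F s]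
      simp_rw [nextStep, tsum_drawStep_mul, markovStrategy, PMF.tsum_pure_mul, F]
      simp
  rw [lintegral_eq_zero_iff (measurable_step k F)] at hF
  filter_upwards [hF] with π hπ
  by_contra hne
  simp [F, hne] at hπ

theorem le_lintegral_state_markovStrategy (σ : ℕ → Q → A) {f : ℕ → Q → ℝ≥0∞} {n : ℕ}
    (h : ∀ k < n, ∀ q, f k q ≤ M.expect (f (k + 1)) q (σ k q)) :
    ∑' q, μ₀ q * f 0 q ≤ ∫⁻ π, f n (π n).state ∂M.pathMeasure μ₀ (markovStrategy σ) := by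
  refine le_lintegral_state_of_subharmonic M μ₀ _ fun k hk => ?_
  filter_upwards [markovStrategy_ae M μ₀ σ k] with π hπ
  rw [hπ]
  exact h k hk _

-- Optional stopping: the payoff is frozen at 1 on the first visit to `T`, where `f` is already at
-- least 1, and before that visit it decreases in expectation.
open Classical in
theorem lintegral_reached_le {f : ℕ → Q → ℝ≥0∞} {n : ℕ} {T : Set Q}
    (h : ∀ k < n, ∀ q a, M.expect (f (k + 1)) q a ≤ f k q)
    (hT : ∀ k ≤ n, ∀ q ∈ T, 1 ≤ f k q) :
    ∫⁻ π, (if ∃ i ≤ n, (π i).state ∈ T then 1 else f n (π n).state) ∂M.pathMeasure μ₀ α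
      ≤ ∑' q, μ₀ q * f 0 q := by
  induction n with
  | zero =>
    rw [← lintegral_state_zero M μ₀ α]
    refine lintegral_mono fun π => ?_
    dsimp only
    split_ifs with hi
    · obtain ⟨i, hi, hq⟩ := hi
      obtain rfl : i = 0 := by omega
      exact hT 0 le_rfl _ hq
    · exact le_rfl
  | succ n ih =>
    refine le_trans ?_ (ih (fun k hk => h k (hk.trans n.lt_succ_self))
      fun k hk => hT k (hk.trans n.le_succ))
    let B : (Finset.Iic n → MDPStep Q A) → Prop := fun x => ∃ i, (x i).state ∈ T
    let G₁ : (Finset.Iic n → MDPStep Q A) → ℝ≥0∞ := fun x => if B x then 1 else 0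
    let G₀ : (Finset.Iic n → MDPStep Q A) → ℝ≥0∞ := fun x => if B x then 0 else 1
    have hB : ∀ π : ℕ → MDPStep Q A,
        B (Preorder.frestrictLe n π) ↔ ∃ i ≤ n, (π i).state ∈ T := by
      intro π
      simp [B]
    have hm : Measurable fun π : ℕ → MDPStep Q A => G₁ (Preorder.frestrictLe n π) :=
      (measurable_of_countable G₁).comp (by fun_prop)
    calc ∫⁻ π, (if ∃ i ≤ n + 1, (π i).state ∈ T then 1 else f (n + 1) (π (n + 1)).state)
            ∂M.pathMeasure μ₀ α
        ≤ ∫⁻ π, (G₁ (Preorder.frestrictLe n π)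
            + G₀ (Preorder.frestrictLe n π) * f (n + 1) (π (n + 1)).state)
            ∂M.pathMeasure μ₀ α := by
          refine lintegral_mono fun π => ?_
          simp only [G₁, G₀, hB]
          by_cases h1 : ∃ i ≤ n, (π i).state ∈ T
          · obtain ⟨i, hi, hq⟩ := h1
            rw [if_pos ⟨i, by omega, hq⟩, if_pos ⟨i, hi, hq⟩]
            exact le_self_add
          · rw [if_neg h1, if_neg h1, zero_add, one_mul]
            split_ifs with h2
            · obtain ⟨i, hi, hq⟩ := h2
              obtain rfl : i = n + 1 := by
                by_contra hne
                exact h1 ⟨i, by omega, hq⟩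
              exact hT _ le_rfl _ hq
            · exact le_rfl
      _ = ∫⁻ π, (G₁ (Preorder.frestrictLe n π)
            + G₀ (Preorder.frestrictLe n π) *
              M.expect (f (n + 1)) (π n).state (π n).action) ∂M.pathMeasure μ₀ α := by
          rw [lintegral_add_left hm, lintegral_add_left hm, lintegral_succ_state]
      _ ≤ _ := by
          refine lintegral_mono fun π => ?_
          simp only [G₁, G₀, hB]
          split_ifs
          · simp
          · simpa using h n n.lt_succ_self _ _

open Classical in
theorem measure_reachAt (n : ℕ) (T : Set Q) : M.pathMeasure μ₀ α (reachAt A n T)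
    = ∫⁻ π, (if (π n).state ∈ T then 1 else 0) ∂M.pathMeasure μ₀ α := by
  rw [← lintegral_indicator_one (measurableSet_reachAt n T)]
  rfl

theorem exists_lt_measure_reached {T : Set Q} {c : ℝ≥0∞}
    (h : c < M.pathMeasure μ₀ α (reach A T)) :
    ∃ n, c < M.pathMeasure μ₀ α {π | ∃ i ≤ n, (π i).state ∈ T} := by
  have hU : reach A T = ⋃ n : ℕ, {π : ℕ → MDPStep Q A | ∃ i ≤ n, (π i).state ∈ T} := by
    ext π
    simp only [reach, Set.mem_ofPred_eq, Set.mem_iUnion]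
    exact ⟨fun ⟨i, hi⟩ => ⟨i, i, le_rfl, hi⟩, fun ⟨_, i, _, hi⟩ => ⟨i, hi⟩⟩
  have hmono : Monotone fun n : ℕ => {π : ℕ → MDPStep Q A | ∃ i ≤ n, (π i).state ∈ T} :=
    fun m n hmn π ⟨i, hi, hq⟩ => ⟨i, hi.trans hmn, hq⟩
  rw [hU, hmono.measure_iUnion] at h
  exact lt_iSup_iff.1 h

theorem measure_reached_le {f : ℕ → Q → ℝ≥0∞} {n : ℕ} {T : Set Q}
    (h : ∀ k < n, ∀ q a, M.expect (f (k + 1)) q a ≤ f k q)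
    (hT : ∀ k ≤ n, ∀ q ∈ T, 1 ≤ f k q) :
    M.pathMeasure μ₀ α {π | ∃ i ≤ n, (π i).state ∈ T} ≤ ∑' q, μ₀ q * f 0 q := by
  classical
  refine le_trans ?_ (lintegral_reached_le M μ₀ α h hT)
  refine le_trans ?_ (meas_le_lintegral₀ ?_ fun π (hπ : ∃ i ≤ n, (π i).state ∈ T) => ?_)
  · exact le_rfl
  · refine (Measurable.ite ?_ measurable_const
      (measurable_step n fun s => f n s.state)).aemeasurable
    have : {π : ℕ → MDPStep Q A | ∃ i ≤ n, (π i).state ∈ T}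
        = ⋃ i ∈ Set.Iic n, reachAt A i T := by
      ext π
      simp [reachAt]
    rw [this]
    exact MeasurableSet.biUnion (Set.to_countable _) fun i _ => measurableSet_reachAt i T
  · rw [if_pos hπ]

theorem sumOn_symbolicOutcome (n : ℕ) (T : Set Q) :
    sumOn T (M.symbolicOutcome μ₀ α n) = M.pathMeasure μ₀ α (reachAt A n T) :=
  tsum_measure_preimage_singleton (f := fun π : ℕ → MDPStep Q A => (π n).state)
    (Set.to_countable T) fun q _ => measurableSet_reachAt n {q}

end PathMeasure

end MDP

/-! ### The value function of the safe finite-horizon problem -/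

namespace MDP

variable {Q : Type u} {A : Type v}

theorem expect_indicator_eq_one_iff (M : MDP Q A) {T : Set Q} {q : Q} {a : A} :
    M.expect (T.indicator 1) q a = 1 ↔ M.post q a ⊆ T := by
  have h : M.expect (T.indicator 1) q a = (M.δ q a).toOuterMeasure T := by
    rw [PMF.toOuterMeasure_apply]
    refine tsum_congr fun q' => ?_
    by_cases hq : q' ∈ T <;> simp [hq]
  rw [h, PMF.toOuterMeasure_apply_eq_one_iff, post]

theorem pre_mono (M : MDP Q A) : Monotone M.Pre :=
  fun _ _ h _ ⟨a, ha⟩ => ⟨a, ha.trans h⟩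

theorem pre_iterate_mod (M : MDP Q A) {Z : Set Q} {r : ℕ} (hZ : M.Pre^[r] Z = Z) (n : ℕ) :
    M.Pre^[n % r] Z = M.Pre^[n] Z := by
  conv_rhs => rw [← Nat.mod_add_div n r, Function.iterate_add_apply, Function.iterate_mul,
    Function.iterate_fixed hZ]

/-- The optimal probability of being in `R` after `n` steps, over the strategies that surely keep
the process on course to be in `Z` after `n` steps. -/
noncomputable def safeValue (M : MDP Q A) (R Z : Set Q) : ℕ → Q → ℝ≥0∞
  | 0 => R.indicator 1
  | n + 1 => fun q => ⨆ a, ⨆ _ : M.post q a ⊆ M.Pre^[n] Z, M.expect (safeValue M R Z n) q a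

section SafeValue

variable (M : MDP Q A) {R Z : Set Q}

theorem expect_le_safeValue {n : ℕ} {q : Q} {a : A} (h : M.post q a ⊆ M.Pre^[n] Z) :
    M.expect (M.safeValue R Z n) q a ≤ M.safeValue R Z (n + 1) q :=
  le_iSup₂_of_le (f := fun a (_ : M.post q a ⊆ M.Pre^[n] Z) => M.expect (M.safeValue R Z n) q a)
    a h le_rfl

theorem safeValue_le_one (n : ℕ) (q : Q) : M.safeValue R Z n q ≤ 1 := by
  classical
  induction n generalizing q with
  | zero => exact Set.indicator_le_self' (fun _ _ => zero_le) q
  | succ n ih => exact iSup₂_le fun a _ => PMF.tsum_mul_le _ fun q' _ => ih q'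

/-- The actions that surely lead to `R` are admissible because `Pre` is monotone and `R ⊆ Z`. -/
theorem one_le_safeValue (hRZ : R ⊆ Z) (n : ℕ) {q : Q} (hq : q ∈ M.Pre^[n] R) :
    1 ≤ M.safeValue R Z n q := by
  induction n generalizing q with
  | zero => exact (Set.indicator_of_mem hq 1).ge
  | succ n ih =>
    rw [Function.iterate_succ_apply'] at hq
    obtain ⟨a, ha⟩ := hq
    refine le_trans ?_ (M.expect_le_safeValue (ha.trans (M.pre_mono.iterate n hRZ)))
    exact PMF.le_tsum_mul _ fun q' hq' => ih (ha hq')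

theorem safeValue_succ_eq_zero {n : ℕ} {q : Q} (hq : q ∉ M.Pre^[n + 1] Z) :
    M.safeValue R Z (n + 1) q = 0 := by
  rw [Function.iterate_succ_apply'] at hq
  refine le_antisymm (iSup₂_le fun a ha => ?_) zero_le
  exact (hq ⟨a, ha⟩).elim

theorem mem_of_safeValue_pos (hRZ : R ⊆ Z) {n : ℕ} {q : Q} (hq : M.safeValue R Z n q ≠ 0) :
    q ∈ M.Pre^[n] Z := by
  cases n with
  | zero => exact hRZ (Set.mem_of_indicator_ne_zero hq)
  | succ n => exact not_imp_comm.1 M.safeValue_succ_eq_zero hq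

/-- On `Pre^[n + 1] Z` the supremum is over a finite nonempty set, hence attained; elsewhere it is
empty, the value is 0, and any action will do. -/
theorem exists_optimal_action [Finite A] [Nonempty A] (R Z : Set Q) (n : ℕ) (q : Q) :
    ∃ a, (q ∈ M.Pre^[n + 1] Z → M.post q a ⊆ M.Pre^[n] Z) ∧
      M.safeValue R Z (n + 1) q ≤ M.expect (M.safeValue R Z n) q a := by
  by_cases hq : q ∈ M.Pre^[n + 1] Z
  · have hq' := hq
    rw [Function.iterate_succ_apply'] at hq'
    obtain ⟨b, hb⟩ := hq'
    have : Nonempty {a // M.post q a ⊆ M.Pre^[n] Z} := ⟨⟨b, hb⟩⟩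
    obtain ⟨⟨a, ha⟩, h⟩ := exists_eq_ciSup_of_finite
      (f := fun a : {a // M.post q a ⊆ M.Pre^[n] Z} => M.expect (M.safeValue R Z n) q a)
    refine ⟨a, fun _ => ha, ?_⟩
    refine le_of_eq ?_
    change (⨆ a, ⨆ _ : M.post q a ⊆ M.Pre^[n] Z, M.expect (M.safeValue R Z n) q a) = _
    rw [iSup_subtype', ← h]
  · exact ⟨Classical.arbitrary A, fun h => (hq h).elim,
      (M.safeValue_succ_eq_zero hq).trans_le zero_le⟩

theorem exists_optimal_actions [Finite A] [Nonempty A] (R Z : Set Q) :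
    ∃ σ : ℕ → Q → A, ∀ n q, (q ∈ M.Pre^[n + 1] Z → M.post q (σ n q) ⊆ M.Pre^[n] Z) ∧
      M.safeValue R Z (n + 1) q ≤ M.expect (M.safeValue R Z n) q (σ n q) := by
  choose σ hσ using M.exists_optimal_action R Z
  exact ⟨σ, hσ⟩

end SafeValue

theorem nonempty_action_of_strategy (α : Strategy Q A) (q : Q) : Nonempty A :=
  (α 0 Fin.elim0 q).support_nonempty.to_type

/-! ### Synchronization in terms of the value function -/

section Synchronizing

variable [Countable Q] [Countable A] (M : MDP Q A) {R Z : Set Q}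

/-- The conditional probability of entering `T` is at most 1 and has integral 1, so it equals 1
almost everywhere. -/
theorem ae_mem_pre_of_ae_mem (μ₀ : PMF Q) (α : Strategy Q A) {k : ℕ} {T : Set Q}
    (h : ∀ᵐ π ∂M.pathMeasure μ₀ α, (π (k + 1)).state ∈ T) :
    ∀ᵐ π ∂M.pathMeasure μ₀ α, M.post (π k).state (π k).action ⊆ T := by
  have h1 : ∫⁻ π, M.expect (T.indicator 1) (π k).state (π k).action ∂M.pathMeasure μ₀ α = 1 := by
    rw [← lintegral_state_succ, lintegral_congr_ae (g := fun _ => 1)]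
    · simp
    · filter_upwards [h] with π hπ
      exact Set.indicator_of_mem hπ 1
  have hle : ∀ q a, M.expect (T.indicator 1) q a ≤ 1 := fun q a =>
    PMF.tsum_mul_le _ fun q' _ => Set.indicator_le_self' (fun _ _ => zero_le) q'
  have hae := ae_eq_of_ae_le_of_lintegral_le (μ := M.pathMeasure μ₀ α)
    (f := fun π => M.expect (T.indicator 1) (π k).state (π k).action) (g := fun _ => 1)
    (ae_of_all _ fun π => hle _ _) (by rw [h1]; exact ENNReal.one_ne_top) aemeasurable_const
    (by simp [h1])
  filter_upwards [hae] with π hπ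
  exact (M.expect_indicator_eq_one_iff).1 hπ

theorem ae_mem_pre_iterate (μ₀ : PMF Q) (α : Strategy Q A) {n : ℕ} {T : Set Q}
    (h : ∀ᵐ π ∂M.pathMeasure μ₀ α, (π n).state ∈ T) {j k : ℕ} (hjk : k + j = n) :
    ∀ᵐ π ∂M.pathMeasure μ₀ α, (π k).state ∈ M.Pre^[j] T := by
  induction j generalizing k with
  | zero => obtain rfl : k = n := hjk; exact h
  | succ j ih =>
    filter_upwards [M.ae_mem_pre_of_ae_mem μ₀ α (ih (k := k + 1) (by omega))] with π hπ
    rw [Function.iterate_succ_apply']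
    exact ⟨_, hπ⟩

theorem measure_reachAt_le_safeValue (q₀ : Q) (α : Strategy Q A) (n : ℕ)
    (hn : M.pathMeasure (PMF.pure q₀) α (reachAt A n Z) = 1) :
    M.pathMeasure (PMF.pure q₀) α (reachAt A n R) ≤ M.safeValue R Z n q₀ := by
  classical
  have hZ : ∀ᵐ π ∂M.pathMeasure (PMF.pure q₀) α, (π n).state ∈ Z :=
    (prob_compl_eq_zero_iff (measurableSet_reachAt n Z)).2 hn
  have h := lintegral_state_le_of_superharmonic M (PMF.pure q₀) α (n := n)
    (f := fun k => M.safeValue R Z (n - k)) fun k hk => by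
      have hs := M.ae_mem_pre_of_ae_mem _ α (M.ae_mem_pre_iterate _ α hZ
        (k := k + 1) (j := n - (k + 1)) (by omega))
      filter_upwards [hs] with π hπ
      rw [show n - k = n - (k + 1) + 1 by omega]
      exact M.expect_le_safeValue hπ
  rw [PMF.tsum_pure_mul, Nat.sub_zero, Nat.sub_self] at h
  rw [measure_reachAt]
  exact h

theorem mem_winLimitEvent_iff [Finite A] (hRZ : R ⊆ Z) (q₀ : Q) [Nonempty A] :
    PMF.pure q₀ ∈ M.winLimitEvent R Z ↔ ∀ c < 1, ∃ n, c < M.safeValue R Z n q₀ := by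
  classical
  simp only [winLimitEvent, sumOn_symbolicOutcome, Set.mem_ofPred_eq]
  constructor
  · intro h c hc
    obtain ⟨d, hcd, hd⟩ := exists_between hc
    have hd' : d.toReal < 1 := by
      simpa using (ENNReal.toReal_lt_toReal hd.ne_top ENNReal.one_ne_top).2 hd
    obtain ⟨α, n, h1, h2⟩ := h (1 - d.toReal) (by linarith)
    rw [sub_sub_cancel, ENNReal.ofReal_toReal hd.ne_top] at h1
    exact ⟨n, (hcd.trans_le h1).trans_le (M.measure_reachAt_le_safeValue q₀ α n h2)⟩
  · intro h ε hε
    obtain ⟨n, hn⟩ := h (ENNReal.ofReal (1 - ε)) (by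
      rw [← ENNReal.ofReal_one]
      exact (ENNReal.ofReal_lt_ofReal_iff one_pos).2 (by linarith))
    obtain ⟨σ, hσ⟩ := M.exists_optimal_actions R Z
    refine ⟨markovStrategy fun k => σ (n - (k + 1)), n, ?_, ?_⟩
    · have h := le_lintegral_state_markovStrategy M (PMF.pure q₀) (fun k => σ (n - (k + 1)))
        (n := n) (f := fun k => M.safeValue R Z (n - k)) fun k hk q => by
          rw [show n - k = n - (k + 1) + 1 by omega]
          exact (hσ _ q).2
      rw [PMF.tsum_pure_mul, Nat.sub_zero, Nat.sub_self] at h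
      rw [measure_reachAt]
      exact hn.le.trans h
    -- The same strategy surely ends in `Z`: the indicator of `Pre^[n - k] Z` is subharmonic along
    -- it, and it is 1 at `q₀` because the value there is positive.
    · have h := le_lintegral_state_markovStrategy M (PMF.pure q₀) (fun k => σ (n - (k + 1)))
        (n := n) (f := fun k => (M.Pre^[n - k] Z).indicator 1) fun k hk q => by
          rw [show n - k = n - (k + 1) + 1 by omega]
          refine Set.indicator_apply_le' (fun hq => ?_) (fun _ => zero_le)
          exact ((M.expect_indicator_eq_one_iff).2 ((hσ _ q).1 hq)).ge
      rw [PMF.tsum_pure_mul, Nat.sub_zero, Nat.sub_self,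
        Set.indicator_of_mem (M.mem_of_safeValue_pos hRZ (pos_of_gt hn).ne')] at h
      refine le_antisymm prob_le_one ?_
      rw [measure_reachAt]
      exact h

end Synchronizing

/-! ### Reachability in the product in terms of the value function -/

section Product

/-- The function `safeValue n` on the states of the product at position `n` modulo `r`, extended
by `c` to the other positions. -/
noncomputable def productValue (M : MDP Q A) (R Z : Set Q) (r : ℕ) (c : ℝ≥0∞) (n : ℕ) :
    ProductState Q r → ℝ≥0∞
  | none => 0
  | some (q, i) => if (i : ℕ) = n % r then M.safeValue R Z n q else c

theorem productValue_le_one (M : MDP Q A) {R Z : Set Q} {r : ℕ} (n : ℕ) (s : ProductState Q r) :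
    M.productValue R Z r 1 n s ≤ 1 := by
  rcases s with _ | ⟨q, i⟩
  · exact zero_le
  · rw [productValue]
    split_ifs
    · exact M.safeValue_le_one n q
    · exact le_rfl

variable (M : MDP Q A) {R Z : Set Q} {r : ℕ} [NeZero r]

theorem val_sub_one_of_val_eq_mod {i : Fin r} {m : ℕ} (h : (i : ℕ) = (m + 1) % r) :
    ((i - 1 : Fin r) : ℕ) = m % r := by
  have hi : i = Fin.ofNat r m + 1 := by
    ext
    rw [h, Fin.val_add, Fin.val_one', Fin.val_ofNat, Nat.add_mod]
  rw [hi, add_sub_cancel_right, Fin.val_ofNat]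

theorem expect_product_none (f : ProductState Q r → ℝ≥0∞) (a : A) :
    (M.product Z r).expect f none a = f none :=
  PMF.tsum_pure_mul _ _

theorem expect_product_of_isSafe {q : Q} {i : Fin r} {a : A} (h : M.IsSafe Z q i a)
    (f : ProductState Q r → ℝ≥0∞) :
    (M.product Z r).expect f (some (q, i)) a = M.expect (fun q' => f (some (q', i - 1))) q a := by
  simp only [expect, product, if_pos h]
  exact PMF.tsum_map_mul _ _ _

theorem expect_product_of_not_isSafe {q : Q} {i : Fin r} {a : A} (h : ¬M.IsSafe Z q i a)
    (f : ProductState Q r → ℝ≥0∞) :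
    (M.product Z r).expect f (some (q, i)) a = f none := by
  simp only [expect, product, if_neg h]
  exact PMF.tsum_pure_mul _ _

/-- Wrong positions lead only to wrong positions or the sink; the default 1, the largest possible
value, makes the inequality trivial there. -/
theorem expect_productValue_le (hZ : M.Pre^[r] Z = Z) (n : ℕ) (s : ProductState Q r) (a : A) :
    (M.product Z r).expect (M.productValue R Z r 1 n) s a ≤ M.productValue R Z r 1 (n + 1) s := by
  rcases s with _ | ⟨q, i⟩
  · exact (M.expect_product_none _ a).le
  by_cases hs : M.IsSafe Z q i a
  · by_cases hi : (i : ℕ) = (n + 1) % r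
    · have hi' := val_sub_one_of_val_eq_mod hi
      rw [expect_product_of_isSafe M hs]
      simp only [productValue, if_pos hi, if_pos hi']
      refine M.expect_le_safeValue (hs.2.trans ?_)
      rw [hi', M.pre_iterate_mod hZ]
    · rw [productValue, if_neg hi]
      exact PMF.tsum_mul_le _ fun s _ => M.productValue_le_one n s
  · rw [expect_product_of_not_isSafe M hs]
    exact zero_le

theorem one_le_productValue (hRZ : R ⊆ Z) (hR : M.Pre^[r] R = R) (n : ℕ) {s : ProductState Q r}
    (hs : s ∈ productTarget R r) : 1 ≤ M.productValue R Z r 1 n s := by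
  obtain ⟨q, hq, rfl⟩ := hs
  rw [productValue]
  split_ifs with h
  · refine M.one_le_safeValue hRZ n ?_
    rwa [← M.pre_iterate_mod hR, ← h]
  · exact le_rfl

/-- For the lower bound the default at wrong positions is 0, which is trivially subharmonic. -/
theorem productValue_le_expect (hZ : M.Pre^[r] Z = Z) {n : ℕ} {q : Q} {i : Fin r} {a : A}
    (ha : q ∈ M.Pre^[n + 1] Z → M.post q a ⊆ M.Pre^[n] Z)
    (hv : M.safeValue R Z (n + 1) q ≤ M.expect (M.safeValue R Z n) q a) :
    M.productValue R Z r 0 (n + 1) (some (q, i))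
      ≤ (M.product Z r).expect (M.productValue R Z r 0 n) (some (q, i)) a := by
  rw [productValue]
  split_ifs with hi
  · by_cases hq : q ∈ M.Pre^[n + 1] Z
    · have hi' := val_sub_one_of_val_eq_mod hi
      have hs : M.IsSafe Z q i a := by
        rw [IsSafe, hi', hi, M.pre_iterate_mod hZ, M.pre_iterate_mod hZ]
        exact ⟨hq, ha hq⟩
      rw [expect_product_of_isSafe M hs]
      simpa only [productValue, if_pos hi'] using hv
    · rw [M.safeValue_succ_eq_zero hq]
      exact zero_le
  · exact zero_le

theorem limitSureWinning_product_iff [Countable Q] [Finite A] [Nonempty A] (hRZ : R ⊆ Z)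
    (hR : M.Pre^[r] R = R) (hZ : M.Pre^[r] Z = Z) (q₀ : Q) (t : Fin r) :
    (M.product Z r).LimitSureWinning (PMF.pure (some (q₀, t))) (reach A (productTarget R r)) ↔
      ∀ c < 1, ∃ n, n % r = t ∧ c < M.safeValue R Z n q₀ := by
  classical
  rw [LimitSureWinning]
  constructor
  · intro h c hc
    rw [← h] at hc
    obtain ⟨α, hα⟩ := lt_iSup_iff.1 hc
    obtain ⟨n, hn⟩ := exists_lt_measure_reached _ _ _ hα
    have hr : 0 < r := NeZero.pos r
    -- A horizon beyond `n` with residue `t`, so that the starting position matches the remaining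
    -- time.
    have hN : n ≤ t + r * n := (Nat.le_mul_of_pos_left n hr).trans (Nat.le_add_left _ _)
    set N := t + r * n
    have hNt : N % r = t := by
      rw [Nat.add_mul_mod_self_left, Nat.mod_eq_of_lt t.2]
    refine ⟨N, hNt, hn.trans_le ?_⟩
    refine (measure_reached_le (M.product Z r) _ α (n := n)
      (f := fun k => M.productValue R Z r 1 (N - k)) (fun k hk s a => ?_)
      (fun k _ s hs => M.one_le_productValue hRZ hR _ hs)).trans ?_
    · rw [show N - k = N - (k + 1) + 1 by omega]
      exact M.expect_productValue_le hZ _ s a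
    · rw [PMF.tsum_pure_mul, Nat.sub_zero, productValue, if_pos hNt.symm]
  · intro h
    refine le_antisymm (iSup_le fun α => prob_le_one) (le_of_forall_lt fun c hc => ?_)
    obtain ⟨n, hnt, hn⟩ := h c hc
    obtain ⟨σ, hσ⟩ := M.exists_optimal_actions R Z
    let τ : ℕ → ProductState Q r → A := fun k s =>
      s.elim (Classical.arbitrary A) fun p => σ (n - (k + 1)) p.1
    refine lt_iSup_iff.2 ⟨markovStrategy τ, hn.trans_le ?_⟩
    have hle := le_lintegral_state_markovStrategy (M.product Z r) (PMF.pure (some (q₀, t))) τ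
      (n := n) (f := fun k => M.productValue R Z r 0 (n - k)) fun k hk s => by
        rw [show n - k = n - (k + 1) + 1 by omega]
        rcases s with _ | ⟨q, i⟩
        · exact zero_le
        · exact M.productValue_le_expect hZ (hσ _ q).1 (hσ _ q).2
    rw [PMF.tsum_pure_mul, Nat.sub_zero, Nat.sub_self, productValue, if_pos hnt.symm] at hle
    have hsub : reachAt A n (productTarget R r) ⊆ reach A (productTarget R r) :=
      fun π hπ => ⟨n, hπ⟩
    refine (hle.trans ?_).trans (measure_mono hsub)
    rw [measure_reachAt]
    refine lintegral_mono fun π => ?_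
    rcases (π n).state with _ | ⟨q, i⟩
    · exact zero_le
    · rw [productValue]
      by_cases hi : (i : ℕ) = 0 % r
      · obtain rfl : i = 0 := Fin.val_eq_zero_iff.1 (hi.trans (Nat.zero_mod r))
        rw [if_pos hi]
        split_ifs with hT
        · exact M.safeValue_le_one 0 q
        · exact (Set.indicator_of_notMem (fun hq => hT ⟨q, hq, rfl⟩) 1).le
      · rw [if_neg hi]
        exact zero_le

end Product

end MDP

/-! ### The equivalence -/

theorem mainTheorem8 {Q : Type u} {A : Type v} [Finite Q] [Finite A] (M : MDP Q A)
    (R Z : Set Q) (hRZ : R ⊆ Z) (r : ℕ) [NeZero r]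
    (hR : M.Pre^[r] R = R) (hZ : M.Pre^[r] Z = Z) (q₀ : Q) :
    PMF.pure q₀ ∈ M.winLimitEvent R Z ↔
      ∃ t : Fin r, (M.product Z r).LimitSureWinning (PMF.pure (some (q₀, t)))
        (MDP.reach A (MDP.productTarget R r)) := by
  -- Without actions there are no strategies, and both sides fail.
  rcases isEmpty_or_nonempty A with hA | hA
  · refine iff_of_false (fun h => ?_) fun ⟨t, ht⟩ => ?_
    · obtain ⟨α, -⟩ := h 1 one_pos
      exact not_isEmpty_iff.2 (MDP.nonempty_action_of_strategy α q₀) hA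
    · rw [MDP.LimitSureWinning] at ht
      obtain ⟨α, -⟩ := lt_iSup_iff.1 (ht.symm ▸ zero_lt_one)
      exact not_isEmpty_iff.2 (MDP.nonempty_action_of_strategy α none) hA
  simp_rw [M.mem_winLimitEvent_iff hRZ, M.limitSureWinning_product_iff hRZ hR hZ]
  constructor
  · intro h
    -- If each residue `t` had a bound `c t < 1`, their finite maximum would bound all values away
    -- from 1.
    by_contra! hn
    choose c hc hcn using hn
    obtain ⟨n, hlt⟩ := h (Finset.univ.sup c) ((Finset.sup_lt_iff (by simp)).2 fun t _ => hc t)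
    let t : Fin r := Fin.ofNat r n
    exact absurd (hlt.trans_le (hcn t n rfl)) (not_lt.2 (Finset.le_sup (Finset.mem_univ t)))
  · rintro ⟨t, ht⟩ c hc
    obtain ⟨n, -, hn⟩ := ht c hc
    exact ⟨n, hn⟩
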